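/- Let $p,q$ be positive integers and let $(\overline M,\overline g)$ be a smooth Riemannian manifold of dimension $n+r$ with Levi-Civita connection $\overline\nabla$, endowed with a smooth $(1,1)$-tensor field $J$ such that $J^2=pJ+qI$, $\overline g(JX,Y)=\overline g(X,JY)$ for all vector fields $X,Y$, and $\overline\nabla J=0$ (a locally metallic Riemannian manifold). Let $i:M\to\overline M$ be an isometric immersion of an $n$-dimensional smooth Riemannian manifold $(M,g)$ with Levi-Civita connection $\nabla$; vector fields $X$ on $M$ are identified with $i_*X$. Let $N_1,\dots,N_r$ be a smooth local orthonormal frame of the normal bundle of $M$, defined on an open set $U\subseteq M$. On $U$ define the $(1,1)$-tensor field $P$, the $1$-forms $u_\alpha$, the vector fields $\xi_\alpha$ and the functions $a_{\alpha\beta}$ $(1\le\alpha,\beta\le r)$ by the decompositions into tangential and normal parts $$JX=PX+\sum_{\alpha}u_\alpha(X)N_\alpha,\qquad JN_\alpha=\xi_\alpha+\sum_{\beta}a_{\alpha\beta}N_\beta ,$$ and define the second fundamental forms $h_\alpha$, the shape operators $A_\alpha$ and the normal connection coefficients $l_{\alpha\beta}$ as follows: $h_\alpha(X,Y)=\overline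 g(\overline\nabla_XY,N_\alpha)$; $-A_\alpha X$ is the tangential part of $\overline\nabla_XN_\alpha$; and $l_{\alpha\beta}(X)=\overline g(\overline\nabla_XN_\alpha,N_\beta)$. Then, for all smooth vector fields $X,Y$ on $U$ and all $\alpha,\beta\in\{1,\dots,r\}$, the following hold on $U$: $$(\nabla_XP)(Y)=\sum_{\alpha=1}^r h_\alpha(X,Y)\,\xi_\alpha+\sum_{\alpha=1}^r u_\alpha(Y)\,A_\alpha X,$$ $$(\nabla_Xu_\alpha)(Y)=-h_\alpha(X,PY)+\sum_{\beta=1}^r\bigl[l_{\alpha\beta}(X)u_\beta(Y)+a_{\beta\alpha}h_\beta(X,Y)\bigr],$$ $$\nabla_X\xi_\alpha=-P(A_\alpha X)+\sum_{\beta=1}^r a_{\alpha\beta}A_\beta X+\sum_{\beta=1}^r l_{\alpha\beta}(X)\,\xi_\beta,$$ $$X(a_{\alpha\beta})=-u_\alpha(A_\beta X)-u_\beta(A_\alpha X)+\sum_{\gamma=1}^r\bigl[a_{\gamma\beta}\,l_{\alpha\gamma}(X)+a_{\alpha\gamma}\,l_{\beta\gamma}(X)\bigr].$$ -/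

import Mathlib

open Bundle
open scoped Manifold ContDiff

set_option linter.unusedSectionVars false

namespace Metallic

noncomputable section LeviCivita

open VectorField

variable {E : Type*} [NormedAddCommGroup E] [NormedSpace ℝ E] [FiniteDimensional ℝ E]
  {H : Type*} [TopologicalSpace H] (I : ModelWithCorners ℝ E H)
  {M : Type*} [TopologicalSpace M] [ChartedSpace H M] [IsManifold I ∞ M]
  [RiemannianBundle (fun x : M => TangentSpace I x)]

/-- The Koszul expression `X⟨Y,Z⟩ + Y⟨X,Z⟩ - Z⟨X,Y⟩ + ⟨[X,Y],Z⟩ - ⟨[X,Z],Y⟩ - ⟨[Y,Z],X⟩`. -/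
def koszul (Y X Z : Π x : M, TangentSpace I x) (x : M) : ℝ :=
  d% (fun y => inner ℝ (Y y) (Z y)) x (X x) + d% (fun y => inner ℝ (X y) (Z y)) x (Y x)
    - d% (fun y => inner ℝ (X y) (Y y)) x (Z x)
    + inner ℝ (mlieBracket I X Y x) (Z x) - inner ℝ (mlieBracket I X Z x) (Y x)
    - inner ℝ (mlieBracket I Y Z x) (X x)

variable [IsContMDiffRiemannianBundle I ∞ E (fun x : M => TangentSpace I x)]
  {x : M} {X X' Y Y' Z : Π x : M, TangentSpace I x}


theorem mdifferentiableAt_inner_tangent (hX : MDiffAt (T% X) x) (hY : MDiffAt (T% Y) x) :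
    MDiffAt (fun y => inner ℝ (X y) (Y y)) x :=
  MDifferentiableAt.inner_bundle (E := fun x : M => TangentSpace I x) (IB := I) (F := E) hX hY

theorem koszul_tensorial₁ (hY : MDiffAt (T% Y) x) (Z : Π x : M, TangentSpace I x)
    (hZ : MDiffAt (T% Z) x) : TensorialAt I E (fun X => koszul I Y X Z x) x where
  smul {f X} hf hX := by
    have e1 := mvfderiv_fun_mul hf (mdifferentiableAt_inner_tangent I hX hZ)
    have e2 := mvfderiv_fun_mul hf (mdifferentiableAt_inner_tangent I hX hY)
    simp only [koszul, Pi.smul_apply', inner_smul_left, inner_smul_right,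
      mlieBracket_smul_left hf hX, inner_add_left]
    simp [e1, e2]
    simp [real_inner_comm]
    ring
  add {X X'} hX hX' := by
    have e1 := mvfderiv_fun_add (mdifferentiableAt_inner_tangent I hX hZ) (mdifferentiableAt_inner_tangent I hX' hZ)
    have e2 := mvfderiv_fun_add (mdifferentiableAt_inner_tangent I hX hY) (mdifferentiableAt_inner_tangent I hX' hY)
    simp only [koszul, Pi.add_apply, inner_add_left, inner_add_right, mlieBracket_add_left hX hX']
    simp [e1, e2]
    ring

theorem koszul_tensorial₂ (hY : MDiffAt (T% Y) x) (X : Π x : M, TangentSpace I x)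
    (hX : MDiffAt (T% X) x) : TensorialAt I E (fun Z => koszul I Y X Z x) x where
  smul {f Z} hf hZ := by
    have e1 := mvfderiv_fun_mul hf (mdifferentiableAt_inner_tangent I hX hZ)
    have e2 := mvfderiv_fun_mul hf (mdifferentiableAt_inner_tangent I hY hZ)
    simp only [koszul, Pi.smul_apply', inner_smul_left, inner_smul_right,
      mlieBracket_smul_right hf hZ, inner_add_left]
    simp [e1, e2]
    simp [real_inner_comm]
    ring
  add {Z Z'} hZ hZ' := by
    have e1 := mvfderiv_fun_add (mdifferentiableAt_inner_tangent I hX hZ)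
      (mdifferentiableAt_inner_tangent I hX hZ')
    have e2 := mvfderiv_fun_add (mdifferentiableAt_inner_tangent I hY hZ)
      (mdifferentiableAt_inner_tangent I hY hZ')
    simp only [koszul, Pi.add_apply, inner_add_left, inner_add_right, mlieBracket_add_right hZ hZ']
    simp [e1, e2]
    ring

theorem koszul_add (hY : MDiffAt (T% Y) x) (hY' : MDiffAt (T% Y') x) (hX : MDiffAt (T% X) x)
    (hZ : MDiffAt (T% Z) x) :
    koszul I (Y + Y') X Z x = koszul I Y X Z x + koszul I Y' X Z x := by
  have e1 := mvfderiv_fun_add (mdifferentiableAt_inner_tangent I hY hZ)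
    (mdifferentiableAt_inner_tangent I hY' hZ)
  have e2 := mvfderiv_fun_add (mdifferentiableAt_inner_tangent I hX hY)
    (mdifferentiableAt_inner_tangent I hX hY')
  simp only [koszul, Pi.add_apply, inner_add_left, inner_add_right, mlieBracket_add_left hY hY',
    mlieBracket_add_right hY hY']
  simp [e1, e2]
  ring

theorem koszul_leibniz {f : M → ℝ} (hf : MDiffAt f x) (hY : MDiffAt (T% Y) x)
    (hX : MDiffAt (T% X) x) (hZ : MDiffAt (T% Z) x) :
    koszul I (f • Y) X Z x
      = f x * koszul I Y X Z x + 2 * (d% f x (X x) * inner ℝ (Y x) (Z x)) := by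
  have e1 := mvfderiv_fun_mul hf (mdifferentiableAt_inner_tangent I hY hZ)
  have e2 := mvfderiv_fun_mul hf (mdifferentiableAt_inner_tangent I hX hY)
  simp only [koszul, Pi.smul_apply', inner_smul_left, inner_smul_right, inner_add_left,
    mlieBracket_smul_left hf hY, mlieBracket_smul_right hf hY]
  simp [e1, e2]
  simp [real_inner_comm]
  ring

instance instFiniteDimensionalTangentSpace (x : M) : FiniteDimensional ℝ (TangentSpace I x) :=
  inferInstanceAs (FiniteDimensional ℝ E)

/-- The Koszul expression is tensorial in `X` and `Z`, so that it defines a bilinear form on each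
tangent space. -/
def koszulForm (hY : MDiffAt (T% Y) x) :
    TangentSpace I x →L[ℝ] TangentSpace I x →L[ℝ] ℝ :=
  TensorialAt.mkHom₂ (fun X Z => koszul I Y X Z x) x (koszul_tensorial₁ I hY)
    (koszul_tensorial₂ I hY)

/-- The endomorphism `B` with `⟨B v, w⟩ = b v w` (index raising), in an orthonormal basis. -/
def sharp (b : TangentSpace I x →L[ℝ] TangentSpace I x →L[ℝ] ℝ) :
    TangentSpace I x →L[ℝ] TangentSpace I x :=
  ∑ k, (b.flip (stdOrthonormalBasis ℝ (TangentSpace I x) k)).smulRight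
    (stdOrthonormalBasis ℝ (TangentSpace I x) k)

theorem inner_sharp (b : TangentSpace I x →L[ℝ] TangentSpace I x →L[ℝ] ℝ)
    (v w : TangentSpace I x) : inner ℝ (sharp I b v) w = b v w := by
  conv_rhs => rw [← (stdOrthonormalBasis ℝ (TangentSpace I x)).sum_repr' w]
  simp [sharp, sum_inner, inner_smul_left, map_sum, mul_comm]

open Classical in
/-- `v ↦ ∇_v Y`, determined by `2⟨∇_X Y, Z⟩ = koszul Y X Z` where `Y` is differentiable. -/
def leviCivitaFun (Y : Π x : M, TangentSpace I x) (x : M) :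
    TangentSpace I x →L[ℝ] TangentSpace I x :=
  if hY : MDiffAt (T% Y) x then (2⁻¹ : ℝ) • sharp I (koszulForm I hY) else 0

theorem inner_leviCivitaFun (hY : MDiffAt (T% Y) x) (hX : MDiffAt (T% X) x)
    (hZ : MDiffAt (T% Z) x) :
    inner ℝ (leviCivitaFun I Y x (X x)) (Z x) = 2⁻¹ * koszul I Y X Z x := by
  have := TensorialAt.mkHom₂_apply (koszul_tensorial₁ I hY) (koszul_tensorial₂ I hY) hX hZ
  simp [leviCivitaFun, hY, inner_smul_left, inner_sharp, koszulForm, this]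

theorem clm_ext_tangent {A B : TangentSpace I x →L[ℝ] TangentSpace I x}
    (h : ∀ X Z : Π x : M, TangentSpace I x, MDiffAt (T% X) x → MDiffAt (T% Z) x →
      inner ℝ (A (X x)) (Z x) = inner ℝ (B (X x)) (Z x)) : A = B := by
  ext v
  refine ext_inner_right ℝ fun w => ?_
  simpa using h (FiberBundle.extend E v) (FiberBundle.extend E w)
    (FiberBundle.mdifferentiableAt_extend ..) (FiberBundle.mdifferentiableAt_extend ..)

variable (M) in
/-- The Levi-Civita connection of the Riemannian manifold `M`. As usual in Mathlib, the argument
order is `leviCivita I M Y x (X x) = (∇_X Y)(x)`. It is torsion-free and metric: see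
`leviCivita_torsion` and `leviCivita_metric`. -/
def leviCivita : CovariantDerivative I E (TangentSpace I : M → Type _) where
  toFun := leviCivitaFun I
  isCovariantDerivativeOnUniv :=
    { add := by
        intro Y Y' x hY hY' _
        refine clm_ext_tangent I fun X Z hX hZ => ?_
        rw [inner_leviCivitaFun I (mdifferentiableAt_add_section hY hY') hX hZ]
        simp [inner_add_left, inner_leviCivitaFun I _ hX hZ, hY, hY', koszul_add I hY hY' hX hZ]
        ring
      leibniz := by
        intro Y f x hY hf _
        refine clm_ext_tangent I fun X Z hX hZ => ?_
        rw [inner_leviCivitaFun I (hf.smul_section hY) hX hZ]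
        simp [inner_add_left, inner_smul_left, inner_leviCivitaFun I hY hX hZ,
          koszul_leibniz I hf hY hX hZ]
        ring }

theorem leviCivita_koszul (hY : MDiffAt (T% Y) x) (hX : MDiffAt (T% X) x)
    (hZ : MDiffAt (T% Z) x) :
    2 * inner ℝ (leviCivita I M Y x (X x)) (Z x) = koszul I Y X Z x := by
  change 2 * inner ℝ (leviCivitaFun I Y x (X x)) (Z x) = _
  rw [inner_leviCivitaFun I hY hX hZ]; ring

theorem leviCivita_torsion : (leviCivita I M).torsion = 0 := by
  rw [CovariantDerivative.torsion_eq_zero_iff]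
  intro X Y x hX hY
  refine ext_inner_right ℝ fun w => ?_
  have hZ : MDiffAt (T% (FiberBundle.extend E w : Π x : M, TangentSpace I x)) x :=
    FiberBundle.mdifferentiableAt_extend ..
  have h1 := leviCivita_koszul I hY hX hZ
  have h2 := leviCivita_koszul I hX hY hZ
  have h3 : (fun y => inner ℝ (X y) (Y y)) = fun y => inner ℝ (Y y) (X y) := by
    ext y; exact real_inner_comm _ _
  simp only [koszul, FiberBundle.extend_apply_self, mlieBracket_swap_apply (V := Y) (W := X),
    inner_neg_left, h3] at h1 h2
  rw [inner_sub_left]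
  linarith

theorem leviCivita_metric (hX : MDiffAt (T% X) x) (hY : MDiffAt (T% Y) x)
    (v : TangentSpace I x) :
    d% (fun y => inner ℝ (X y) (Y y)) x v
      = inner ℝ (leviCivita I M X x v) (Y x) + inner ℝ (X x) (leviCivita I M Y x v) := by
  have hV : MDiffAt (T% (FiberBundle.extend E v : Π x : M, TangentSpace I x)) x :=
    FiberBundle.mdifferentiableAt_extend ..
  have h1 := leviCivita_koszul I hX hV hY
  have h2 := leviCivita_koszul I hY hV hX
  have h3 (A B : Π x : M, TangentSpace I x) :
      d% (fun y => inner ℝ (A y) (B y)) x = d% (fun y => inner ℝ (B y) (A y)) x := by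
    congr 1; ext y; exact real_inner_comm _ _
  simp only [koszul, FiberBundle.extend_apply_self, mlieBracket_swap_apply (V := Y) (W := X),
    inner_neg_left, h3 Y X] at h1 h2
  rw [real_inner_comm (leviCivita I M Y x v)]
  linarith

end LeviCivita

noncomputable section Submanifold

variable {E : Type*} [NormedAddCommGroup E] [NormedSpace ℝ E]
  {H : Type*} [TopologicalSpace H] (I : ModelWithCorners ℝ E H)
  {M : Type*} [TopologicalSpace M] [ChartedSpace H M] [IsManifold I ∞ M]
  {E' : Type*} [NormedAddCommGroup E'] [NormedSpace ℝ E']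
  {H' : Type*} [TopologicalSpace H'] (I' : ModelWithCorners ℝ E' H')
  {M' : Type*} [TopologicalSpace M'] [ChartedSpace H' M'] [IsManifold I' ∞ M']

/- ### Covariant derivatives of tensor fields -/

/-- The covariant derivative of a (1,1)-tensor field: `(∇_v T)(Y) = ∇_v (T Y) - T (∇_v Y)`. -/
def covDerivEndo (cov : CovariantDerivative I E (TangentSpace I : M → Type _))
    (T : Π x : M, TangentSpace I x →L[ℝ] TangentSpace I x) (Y : Π x : M, TangentSpace I x)
    (x : M) : TangentSpace I x →L[ℝ] TangentSpace I x :=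
  cov (fun y => T y (Y y)) x - T x ∘L cov Y x

/-- The covariant derivative of a 1-form: `(∇_v u)(Y) = v (u Y) - u (∇_v Y)`. -/
def covDerivForm (cov : CovariantDerivative I E (TangentSpace I : M → Type _))
    (u : Π x : M, TangentSpace I x →L[ℝ] ℝ) (Y : Π x : M, TangentSpace I x)
    (x : M) : TangentSpace I x →L[ℝ] ℝ :=
  mvfderiv I (fun y => u y (Y y)) x - u x ∘L cov Y x

/- ### Metallic structures -/

section Structures

variable [RiemannianBundle (fun x : M' => TangentSpace I' x)]

/-- `(g, J)` is a metallic Riemannian structure on `M'`, where `g` is the given Riemannian metric: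
`J` is a smooth (1,1)-tensor field with `J² = p J + q Id` and `g(JX, Y) = g(X, JY)`. -/
structure IsMetallicRiemannian (p q : ℕ)
    (J : Π x : M', TangentSpace I' x →L[ℝ] TangentSpace I' x) : Prop where
  p_pos : 0 < p
  q_pos : 0 < q
  contMDiff : ContMDiff I' (I'.prod 𝓘(ℝ, E' →L[ℝ] E')) ∞
    (fun x => TotalSpace.mk' (E' →L[ℝ] E')
      (E := fun x : M' => TangentSpace I' x →L[ℝ] TangentSpace I' x) x (J x))
  sq : ∀ (x : M') (v : TangentSpace I' x), J x (J x v) = (p : ℝ) • J x v + (q : ℝ) • v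
  symm : ∀ (x : M') (v w : TangentSpace I' x), inner ℝ (J x v) w = inner ℝ v (J x w)

/-- `(M', g, J)` is locally metallic Riemannian: moreover `∇J = 0` for the Levi-Civita
connection `∇` of `g`. -/
structure IsLocallyMetallicRiemannian [FiniteDimensional ℝ E']
    [IsContMDiffRiemannianBundle I' ∞ E' (fun x : M' => TangentSpace I' x)] (p q : ℕ)
    (J : Π x : M', TangentSpace I' x →L[ℝ] TangentSpace I' x) : Prop
    extends IsMetallicRiemannian I' p q J where
  parallel : ∀ (x : M') (Y : Π x : M', TangentSpace I' x), CMDiffAt ∞ (T% Y) x →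
    covDerivEndo I' (leviCivita I' M') J Y x = 0

end Structures

/- ### Derivatives along a map -/

/-- The pullback connection: for a vector field `V` along `f : M → M'`, written as
`V = ∑ₖ Vᵏ (sₖ ∘ f)` in a local frame `s` of `TM'` near `f x`,
`∇_v V = ∑ₖ (v(Vᵏ) sₖ(f x) + Vᵏ(x) ∇_{f_* v} sₖ)`. -/
def covAlong [FiniteDimensional ℝ E']
    (cov : CovariantDerivative I' E' (TangentSpace I' : M' → Type _)) (f : M → M')
    (V : Π x : M, TangentSpace I' (f x)) (x : M) :
    TangentSpace I x →L[ℝ] TangentSpace I' (f x) :=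
  let t := trivializationAt E' (TangentSpace I' : M' → Type _) (f x)
  let b := Module.finBasis ℝ E'
  ∑ k, ((mvfderiv I (fun y => t.localFrameCoeff I' b k (f y) (V y)) x).smulRight
      (t.localFrame b k (f x))
    + t.localFrameCoeff I' b k (f x) (V x) • (cov (t.localFrame b k) (f x) ∘L mfderiv I I' f x))

variable {I'} in
theorem cov_sum (cov : CovariantDerivative I' E' (TangentSpace I' : M' → Type _)) {ι : Type*}
    (s : Finset ι) {x : M'} {σ : ι → Π y : M', TangentSpace I' y}
    (hσ : ∀ k, MDiffAt (T% (σ k)) x) :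
    cov (fun y => ∑ k ∈ s, σ k y) x = ∑ k ∈ s, cov (σ k) x := by
  classical
  induction s using Finset.induction_on with
  | empty =>
    simp only [Finset.sum_empty]
    exact congrFun cov.zero x
  | insert i s hi ih =>
    simp only [Finset.sum_insert hi, ← ih]
    exact cov.isCovariantDerivativeOnUniv.add (hσ i) (.sum_section fun k _ => hσ k)

variable {I I'} in
/-- For the restriction to `f` of a vector field `W` on `M'`, this is `∇_{f_* v} W`. -/
theorem covAlong_comp [FiniteDimensional ℝ E']
    (cov : CovariantDerivative I' E' (TangentSpace I' : M' → Type _)) {f : M → M'} {x : M}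
    (hf : MDiffAt f x) {W : Π y : M', TangentSpace I' y} (hW : MDiffAt (T% W) (f x)) :
    covAlong I I' cov f (fun y => W (f y)) x = cov W (f x) ∘L mfderiv I I' f x := by
  set t := trivializationAt E' (TangentSpace I' : M' → Type _) (f x) with ht
  set b := Module.finBasis ℝ E' with hb
  have hx : f x ∈ t.baseSet := FiberBundle.mem_baseSet_trivializationAt E' (TangentSpace I') (f x)
  have hs (k) : MDiffAt (T% (t.localFrame b k)) (f x) :=
    (contMDiffAt_localFrame_of_mem 1 _ b k hx).mdifferentiableAt (by simp)
  have hc (k) : MDiffAt (LinearMap.piApply (t.localFrameCoeff I' b k) W) (f x) :=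
    mdifferentiableAt_localFrameCoeff b hx hW k
  have h1 : cov W (f x)
      = cov (fun y => ∑ k, (LinearMap.piApply (t.localFrameCoeff I' b k) W • t.localFrame b k) y)
        (f x) :=
    cov.isCovariantDerivativeOnUniv.congr_of_eventuallyEq hW
      (.sum_section fun k _ ↦ (hc k).smul_section (hs k)) Filter.univ_mem
      (t.eventually_eq_localFrame_sum_coeff_smul b hx)
  rw [h1, cov_sum _ _ fun k => (hc k).smul_section (hs k)]
  ext v
  have h2 (k) : mvfderiv I (fun y => t.localFrameCoeff I' b k (f y) (W (f y))) x
      = mvfderiv I' (LinearMap.piApply (t.localFrameCoeff I' b k) W) (f x) ∘L mfderiv I I' f x := by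
    have := mfderiv_comp x (hc k) hf
    ext v
    exact congr($this v)
  simp only [covAlong, sum_apply, ContinuousLinearMap.comp_apply]
  refine Finset.sum_congr rfl fun k _ => ?_
  rw [h2, cov.isCovariantDerivativeOnUniv.leibniz (hs k) (hc k)]
  simp [add_comm]
  rfl

/- ### Geometry of a submanifold -/

variable [RiemannianBundle (fun x : M => TangentSpace I x)]
  [RiemannianBundle (fun x : M' => TangentSpace I' x)]

/-- `f` is an isometric immersion: smooth, and the metric of `M` is the induced one. -/
structure IsIsometricImmersion (f : M → M') : Prop where
  contMDiff : CMDiff ∞ f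
  inner_mfderiv : ∀ (x : M) (v w : TangentSpace I x),
    inner ℝ (mfderiv I I' f x v) (mfderiv I I' f x w) = inner ℝ v w

/-- `N₁, …, N_r` is a smooth orthonormal frame of normal vector fields along `f` on the set `U`.
(It is a basis of the normal spaces when `r` is the codimension.) -/
structure IsOrthonormalNormalFrameOn {r : ℕ} (f : M → M') (U : Set M)
    (N : Fin r → Π x : M, TangentSpace I' (f x)) : Prop where
  contMDiffOn : ∀ α, ContMDiffOn I I'.tangent ∞
    (fun x => (⟨f x, N α x⟩ : TangentBundle I' M')) U
  orthonormal : ∀ x ∈ U, Orthonormal ℝ (fun α => N α x)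
  normal : ∀ α, ∀ x ∈ U, ∀ v : TangentSpace I x, inner ℝ (mfderiv I I' f x v) (N α x) = 0

variable [FiniteDimensional ℝ E] (f : M → M')

/-- The tangential part: for `w` in the tangent space of `M'` at `f x`, the tangent vector
`∑ₖ ⟨w, f_* eₖ⟩ eₖ` of `M`, where `e` is an orthonormal basis of the tangent space of `M` at `x`.
For an isometric immersion `f`, its image under `f_*` is the orthogonal projection of `w` to the
tangent space of the submanifold. -/
def tangentialPart (x : M) : TangentSpace I' (f x) →L[ℝ] TangentSpace I x :=
  ∑ k, (innerSL ℝ (mfderiv I I' f x (stdOrthonormalBasis ℝ (TangentSpace I x) k))).smulRight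
    (stdOrthonormalBasis ℝ (TangentSpace I x) k)

variable {I I' f} in
theorem inner_tangentialPart (x : M) (w : TangentSpace I' (f x)) (v : TangentSpace I x) :
    inner ℝ (tangentialPart I I' f x w) v = inner ℝ w (mfderiv I I' f x v) := by
  conv_rhs => rw [← (stdOrthonormalBasis ℝ (TangentSpace I x)).sum_repr' v]
  simp only [tangentialPart, map_sum, map_smul, inner_sum, inner_smul_right]
  simp [sum_inner, inner_smul_left, mul_comm, real_inner_comm]

variable {I I' f} in
/-- Orthogonal decomposition into tangential and normal components. -/
theorem tangential_add_normal {r : ℕ} [FiniteDimensional ℝ E']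
    (hdim : Module.finrank ℝ E' = Module.finrank ℝ E + r)
    (hf : IsIsometricImmersion I I' f) {U : Set M}
    {N : Fin r → Π x : M, TangentSpace I' (f x)} (hN : IsOrthonormalNormalFrameOn I I' f U N)
    {x : M} (hx : x ∈ U) (w : TangentSpace I' (f x)) :
    w = mfderiv I I' f x (tangentialPart I I' f x w) + ∑ α, (inner ℝ w (N α x) : ℝ) • N α x := by
  classical
  set e := stdOrthonormalBasis ℝ (TangentSpace I x) with he
  let s : Fin (Module.finrank ℝ (TangentSpace I x)) ⊕ Fin r → TangentSpace I' (f x) :=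
    Sum.elim (fun k => mfderiv I I' f x (e k)) (fun α => N α x)
  have hs : Orthonormal ℝ s := by
    rw [orthonormal_iff_ite]
    rintro (k | α) (l | β)
    · simp [s, hf.inner_mfderiv, orthonormal_iff_ite.1 e.orthonormal k l]
    · simp [s, hN.normal β x hx]
    · simp only [s, Sum.elim_inl, Sum.elim_inr]
      rw [real_inner_comm, hN.normal α x hx]; simp
    · simp [s, orthonormal_iff_ite.1 (hN.orthonormal x hx) α β]
  have hspan : Submodule.span ℝ (Set.range s) = ⊤ := by
    refine hs.linearIndependent.span_eq_top_of_card_eq_finrank' ?_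
    rw [Fintype.card_sum, Fintype.card_fin, Fintype.card_fin]
    exact hdim.symm
  have h := (OrthonormalBasis.mk hs hspan.ge).sum_repr' w
  rw [Fintype.sum_sum_type] at h
  simp only [OrthonormalBasis.coe_mk, s, Sum.elim_inl, Sum.elim_inr] at h
  nth_rewrite 1 [← h]
  simp only [tangentialPart, sum_apply, ContinuousLinearMap.smulRight_apply,
    map_sum, map_smul, innerSL_apply_apply, real_inner_comm w]
  rfl

variable {r : ℕ} (J : Π x : M', TangentSpace I' x →L[ℝ] TangentSpace I' x)
  (N : Fin r → Π x : M, TangentSpace I' (f x))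

/-- `P`: the tangential part of `J f_* X` is `P X`. -/
def inducedP (x : M) : TangentSpace I x →L[ℝ] TangentSpace I x :=
  tangentialPart I I' f x ∘L J (f x) ∘L mfderiv I I' f x

/-- `u_α`: the `N_α`-component of `J f_* X` is `u_α(X)`. -/
def inducedU (α : Fin r) (x : M) : TangentSpace I x →L[ℝ] ℝ :=
  innerSL ℝ (N α x) ∘L J (f x) ∘L mfderiv I I' f x

/-- `ξ_α`: the tangential part of `J N_α`. -/
def inducedXi (α : Fin r) (x : M) : TangentSpace I x :=
  tangentialPart I I' f x (J (f x) (N α x))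

/-- `a_{αβ}`: the `N_β`-component of `J N_α`. -/
def inducedA (α β : Fin r) (x : M) : ℝ :=
  inner ℝ (J (f x) (N α x)) (N β x)

variable [FiniteDimensional ℝ E']
  [IsContMDiffRiemannianBundle I' ∞ E' (fun x : M' => TangentSpace I' x)]

/-- `h_α(X, Y)`: the `N_α`-component of `∇'_X (f_* Y)`. -/
def secondFundamentalForm (α : Fin r) (X Y : Π x : M, TangentSpace I x) (x : M) : ℝ :=
  inner ℝ (covAlong I I' (leviCivita I' M') f (fun y => mfderiv I I' f y (Y y)) x (X x)) (N α x)

/-- The shape operator `A_α`: the tangential part of `∇'_X N_α` is `-A_α X`. -/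
def shapeOperator (α : Fin r) (x : M) : TangentSpace I x →L[ℝ] TangentSpace I x :=
  -(tangentialPart I I' f x ∘L covAlong I I' (leviCivita I' M') f (N α) x)

/-- The coefficients of the normal connection: `l_{αβ}(X)` is the `N_β`-component of
`∇'_X N_α`. -/
def normalConnection (α β : Fin r) (x : M) : TangentSpace I x →L[ℝ] ℝ :=
  innerSL ℝ (N β x) ∘L covAlong I I' (leviCivita I' M') f (N α) x

end Submanifold

end Metallic

open Metallic

namespace Metallic

section Calculus

open Filter Topology

section AlongMap

variable {E : Type*} [NormedAddCommGroup E] [NormedSpace ℝ E]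
  {H : Type*} [TopologicalSpace H] {I : ModelWithCorners ℝ E H}
  {M : Type*} [TopologicalSpace M] [ChartedSpace H M] [IsManifold I ∞ M]
  {E' : Type*} [NormedAddCommGroup E'] [NormedSpace ℝ E'] [FiniteDimensional ℝ E']
  {H' : Type*} [TopologicalSpace H'] {I' : ModelWithCorners ℝ E' H'}
  {M' : Type*} [TopologicalSpace M'] [ChartedSpace H' M'] [IsManifold I' ∞ M']
  {f : M → M'} {x : M} {V W : Π x : M, TangentSpace I' (f x)}

variable (I I' f x V) in
/-- Differentiability at `x` of a vector field along `f`. -/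
def DiffAlongAt : Prop :=
  MDifferentiableAt I I'.tangent (fun y => (⟨f y, V y⟩ : TangentBundle I' M')) x

variable (I' f x) in
/-- The local frame of `TM'` around `f x` that is used by `covAlong`. -/
noncomputable def frameAt (k : Fin (Module.finrank ℝ E')) (z : M') : TangentSpace I' z :=
  (trivializationAt E' (TangentSpace I' : M' → Type _) (f x)).localFrame (Module.finBasis ℝ E') k z

variable (I' f x) in
/-- The coefficients with respect to `frameAt`. -/
noncomputable def coeffAt (k : Fin (Module.finrank ℝ E')) (z : M') : TangentSpace I' z →ₗ[ℝ] ℝ :=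
  (trivializationAt E' (TangentSpace I' : M' → Type _) (f x)).localFrameCoeff I'
    (Module.finBasis ℝ E') k z

theorem DiffAlongAt.mdifferentiableAt_base (hV : DiffAlongAt I I' f x V) : MDiffAt f x :=
  ((mdifferentiableAt_totalSpace ..).1 hV).1

theorem DiffAlongAt.continuousAt_base (hV : DiffAlongAt I I' f x V) : ContinuousAt f x :=
  hV.mdifferentiableAt_base.continuousAt

theorem mem_baseSet_frameAt (z : M') :
    z ∈ (trivializationAt E' (TangentSpace I' : M' → Type _) z).baseSet :=
  FiberBundle.mem_baseSet_trivializationAt E' (TangentSpace I') z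

theorem mdifferentiableAt_frameAt (k) : MDiffAt (T% (frameAt I' f x k)) (f x) :=
  (contMDiffAt_localFrame_of_mem 1 _ (Module.finBasis ℝ E') k
    (mem_baseSet_frameAt (f x))).mdifferentiableAt (by simp)

theorem contMDiffAt_frameAt (k) : CMDiffAt ∞ (T% (frameAt I' f x k)) (f x) :=
  contMDiffAt_localFrame_of_mem ∞ _ (Module.finBasis ℝ E') k (mem_baseSet_frameAt (f x))

open Classical in
theorem DiffAlongAt.mdifferentiableAt_coeffAt (hV : DiffAlongAt I I' f x V) (k) :
    MDiffAt (fun y => coeffAt I' f x k (f y) (V y)) x := by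
  obtain ⟨h1, h2⟩ := (mdifferentiableAt_totalSpace ..).1 hV
  set t := trivializationAt E' (TangentSpace I' : M' → Type _) (f x) with ht
  have h3 : MDiffAt (fun y => (Module.finBasis ℝ E').coord k
      (t (⟨f y, V y⟩ : TangentBundle I' M')).2) x := by
    have : MDifferentiableAt 𝓘(ℝ, E') 𝓘(ℝ)
        ((Module.finBasis ℝ E').coord k).toContinuousLinearMap
        (t (⟨f x, V x⟩ : TangentBundle I' M')).2 :=
      mdifferentiableAt_iff_differentiableAt.mpr <| by fun_prop
    exact this.comp x h2
  refine h3.congr_of_eventuallyEq ?_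
  have h4 : ∀ᶠ y in 𝓝 x, f y ∈ t.baseSet :=
    hV.continuousAt_base.eventually (t.open_baseSet.mem_nhds (mem_baseSet_frameAt (f x)))
  filter_upwards [h4] with y hy
  have := t.localFrameCoeff_eq_coeff (I := I') (b := Module.finBasis ℝ E')
    (s := fun z => if h : z = f y then h ▸ V y else 0) hy (i := k)
  simpa [coeffAt, ← ht] using this

open Classical in
theorem sum_coeffAt_frameAt {z : M'}
    (hz : z ∈ (trivializationAt E' (TangentSpace I' : M' → Type _) (f x)).baseSet)
    (v : TangentSpace I' z) : v = ∑ k, coeffAt I' f x k z v • frameAt I' f x k z := by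
  have := Bundle.Trivialization.eq_sum_localFrameCoeff_smul (I := I')
    (e := trivializationAt E' (TangentSpace I' : M' → Type _) (f x)) (b := Module.finBasis ℝ E')
    (s := fun z' => if h : z' = z then h ▸ v else 0) hz
  simpa using! this

theorem coeffAt_frameAt {z : M'}
    (hz : z ∈ (trivializationAt E' (TangentSpace I' : M' → Type _) (f x)).baseSet) (k l) :
    coeffAt I' f x k z (frameAt I' f x l z) = if l = k then 1 else 0 := by
  have := Bundle.Trivialization.localFrameCoeff_apply_of_mem_baseSet (I := I')
    (trivializationAt E' (TangentSpace I' : M' → Type _) (f x)) (Module.finBasis ℝ E') hz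
    (frameAt I' f x l) k
  rw [coeffAt, this, frameAt, Bundle.Trivialization.localFrame_apply_of_mem_baseSet _ _ hz,
    Module.Basis.repr_self, Finsupp.single_apply]

theorem eventually_sum_coeffAt_frameAt (hf : ContinuousAt f x)
    (V : Π x : M, TangentSpace I' (f x)) :
    ∀ᶠ y in 𝓝 x, V y = ∑ k, coeffAt I' f x k (f y) (V y) • frameAt I' f x k (f y) := by
  have h4 := hf.eventually ((trivializationAt E' (TangentSpace I' : M' → Type _)
    (f x)).open_baseSet.mem_nhds (mem_baseSet_frameAt (f x)))
  filter_upwards [h4] with y hy using sum_coeffAt_frameAt hy _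

variable (cov : CovariantDerivative I' E' (TangentSpace I' : M' → Type _))

theorem covAlong_apply (V : Π x : M, TangentSpace I' (f x)) (x : M) (v : TangentSpace I x) :
    covAlong I I' cov f V x v
      = ∑ k, (mvfderiv I (fun y => coeffAt I' f x k (f y) (V y)) x v • frameAt I' f x k (f x)
        + coeffAt I' f x k (f x) (V x) • cov (frameAt I' f x k) (f x) (mfderiv I I' f x v)) := by
  simp only [covAlong, sum_apply]
  rfl

theorem mvfderiv_congr_nhds {F : Type*} [NormedAddCommGroup F] [NormedSpace ℝ F] {g g' : M → F}
    (h : g =ᶠ[𝓝 x] g') : mvfderiv I g x = mvfderiv I g' x := by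
  ext v
  have := h.mfderiv_eq (I := I) (I' := 𝓘(ℝ, F))
  exact congr($this v)

theorem covAlong_congr (h : ∀ᶠ y in 𝓝 x, V y = W y) :
    covAlong I I' cov f V x = covAlong I I' cov f W x := by
  ext v
  rw [covAlong_apply, covAlong_apply, h.self_of_nhds]
  refine Finset.sum_congr rfl fun k _ => ?_
  have h2 : (fun y => coeffAt I' f x k (f y) (V y)) =ᶠ[𝓝 x]
      fun y => coeffAt I' f x k (f y) (W y) := by
    filter_upwards [h] with y hy
    rw [hy]
  rw [mvfderiv_congr_nhds h2]

theorem mvfderiv_fun_sum {ι : Type*} (s : Finset ι) {F : Type*} [NormedAddCommGroup F]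
    [NormedSpace ℝ F] {g : ι → M → F} (hg : ∀ k ∈ s, MDiffAt (g k) x) :
    MDiffAt (fun y => ∑ k ∈ s, g k y) x ∧
    mvfderiv I (fun y => ∑ k ∈ s, g k y) x = ∑ k ∈ s, mvfderiv I (g k) x := by
  classical
  induction s using Finset.induction_on with
  | empty =>
    simp only [Finset.sum_empty]
    exact ⟨mdifferentiableAt_const, mvfderiv_zero⟩
  | insert i s hi ih =>
    obtain ⟨h1, h2⟩ := ih fun k hk => hg k (Finset.mem_insert_of_mem hk)
    have h0 := hg i (Finset.mem_insert_self _ _)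
    simp only [Finset.sum_insert hi]
    exact ⟨h0.add h1, by rw [← h2]; exact mvfderiv_add h0 h1⟩

theorem covAlong_sum {ι : Type*} (s : Finset ι) {V : ι → Π x : M, TangentSpace I' (f x)}
    (hV : ∀ k ∈ s, DiffAlongAt I I' f x (V k)) :
    covAlong I I' cov f (fun y => ∑ k ∈ s, V k y) x = ∑ k ∈ s, covAlong I I' cov f (V k) x := by
  ext v
  simp only [covAlong_apply, map_sum, sum_apply]
  rw [Finset.sum_comm]
  refine Finset.sum_congr rfl fun l _ => ?_
  rw [(mvfderiv_fun_sum s fun k hk => (hV k hk).mdifferentiableAt_coeffAt l).2]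
  simp [Finset.sum_add_distrib, Finset.sum_smul]

theorem covAlong_smul {c : M → ℝ} (hc : MDiffAt c x) (hV : DiffAlongAt I I' f x V)
    (v : TangentSpace I x) :
    covAlong I I' cov f (fun y => c y • V y) x v
      = mvfderiv I c x v • V x + c x • covAlong I I' cov f V x v := by
  simp only [covAlong_apply, map_smul, smul_eq_mul]
  nth_rewrite 2 [sum_coeffAt_frameAt (I' := I') (mem_baseSet_frameAt (f x)) (V x)]
  rw [Finset.smul_sum, Finset.smul_sum, ← Finset.sum_add_distrib]
  refine Finset.sum_congr rfl fun l _ => ?_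
  rw [mvfderiv_fun_mul hc (hV.mdifferentiableAt_coeffAt l)]
  simp
  module

theorem diffAlongAt_comp (hf : MDiffAt f x) {W : Π y : M', TangentSpace I' y}
    (hW : MDiffAt (T% W) (f x)) : DiffAlongAt I I' f x (fun y => W (f y)) :=
  MDifferentiableAt.comp x hW hf

theorem _root_.MDifferentiableAt.smul_along {c : M → ℝ} (hc : MDiffAt c x)
    (hV : DiffAlongAt I I' f x V) : DiffAlongAt I I' f x (fun y => c y • V y) := by
  have h := (mdifferentiableAt_totalSpace ..).1 hV
  refine (mdifferentiableAt_totalSpace ..).2 ⟨h.1, (hc.smul h.2).congr_of_eventuallyEq ?_⟩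
  have h4 := hV.continuousAt_base.eventually ((trivializationAt E' (TangentSpace I' : M' → Type _)
    (f x)).open_baseSet.mem_nhds (mem_baseSet_frameAt (f x)))
  filter_upwards [h4] with y hy
  exact ((trivializationAt E' (TangentSpace I' : M' → Type _) (f x)).linear ℝ hy).2 _ _

section Metric

variable [RiemannianBundle (fun x : M' => TangentSpace I' x)]
  [IsContMDiffRiemannianBundle I' ∞ E' (fun x : M' => TangentSpace I' x)]

theorem DiffAlongAt.inner (hV : DiffAlongAt I I' f x V) (hW : DiffAlongAt I I' f x W) :
    MDiffAt (fun y => inner ℝ (V y) (W y)) x :=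
  MDifferentiableAt.inner_bundle (E := fun x : M' => TangentSpace I' x) (IB := I') (F := E')
    (IM := I) hV hW

theorem covAlong_metric_of_frameAt (hV : DiffAlongAt I I' f x V) (hW : DiffAlongAt I I' f x W)
    (v : TangentSpace I x)
    (h : ∀ k, mvfderiv I (fun y => inner ℝ (frameAt I' f x k (f y)) (W y)) x v
      = inner ℝ (covAlong I I' (leviCivita I' M') f (fun y => frameAt I' f x k (f y)) x v) (W x)
        + inner ℝ (frameAt I' f x k (f x)) (covAlong I I' (leviCivita I' M') f W x v)) :
    mvfderiv I (fun y => inner ℝ (V y) (W y)) x v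
      = inner ℝ (covAlong I I' (leviCivita I' M') f V x v) (W x)
        + inner ℝ (V x) (covAlong I I' (leviCivita I' M') f W x v) := by
  have hf := hV.mdifferentiableAt_base
  have hs (k) := diffAlongAt_comp hf (mdifferentiableAt_frameAt (I' := I') (f := f) (x := x) k)
  have h1 : (fun y => inner ℝ (V y) (W y)) =ᶠ[𝓝 x] fun y => ∑ k,
      coeffAt I' f x k (f y) (V y) * inner ℝ (frameAt I' f x k (f y)) (W y) := by
    filter_upwards [eventually_sum_coeffAt_frameAt hf.continuousAt V] with y hy
    nth_rewrite 1 [hy]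
    simp [sum_inner, inner_smul_left]
  have h2 (k) := mvfderiv_fun_mul (hV.mdifferentiableAt_coeffAt k) ((hs k).inner hW)
  rw [mvfderiv_congr_nhds h1,
    (mvfderiv_fun_sum _ (g := fun k y => coeffAt I' f x k (f y) (V y)
      * inner ℝ (frameAt I' f x k (f y)) (W y)) fun k _ =>
      (hV.mdifferentiableAt_coeffAt k).mul ((hs k).inner hW)).2]
  rw [sum_coeffAt_frameAt (I' := I') (mem_baseSet_frameAt (f x)) (V x)]
  rw [covAlong_apply]
  simp only [sum_apply, sum_inner, ← Finset.sum_add_distrib]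
  refine Finset.sum_congr rfl fun k _ => ?_
  have h3 := h k
  rw [covAlong_comp _ hf (mdifferentiableAt_frameAt k)] at h3
  rw [h2 k]
  simp [h3, inner_add_left, inner_smul_left]
  ring

theorem covAlong_metric (hV : DiffAlongAt I I' f x V) (hW : DiffAlongAt I I' f x W)
    (v : TangentSpace I x) :
    mvfderiv I (fun y => inner ℝ (V y) (W y)) x v
      = inner ℝ (covAlong I I' (leviCivita I' M') f V x v) (W x)
        + inner ℝ (V x) (covAlong I I' (leviCivita I' M') f W x v) := by
  have hf := hV.mdifferentiableAt_base
  have hs (k) := diffAlongAt_comp hf (mdifferentiableAt_frameAt (I' := I') (f := f) (x := x) k)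
  have hcomm (A B : Π x : M, TangentSpace I' (f x)) :
      (fun y => inner ℝ (A y) (B y)) = fun y => inner ℝ (B y) (A y) := by
    ext y; exact real_inner_comm _ _
  refine covAlong_metric_of_frameAt hV hW v fun k => ?_
  rw [hcomm, add_comm, real_inner_comm _ (frameAt I' f x k (f x)), real_inner_comm (W x)]
  refine covAlong_metric_of_frameAt hW (hs k) v fun l => ?_
  have h1 := leviCivita_metric I' (mdifferentiableAt_frameAt (I' := I') (f := f) (x := x) l)
    (mdifferentiableAt_frameAt (I' := I') (f := f) (x := x) k) (mfderiv I I' f x v)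
  have h2 := mvfderiv_comp_apply x (mdifferentiableAt_inner_tangent I'
    (mdifferentiableAt_frameAt (I' := I') (f := f) (x := x) l)
    (mdifferentiableAt_frameAt (I' := I') (f := f) (x := x) k)) hf v
  rw [covAlong_comp _ hf (mdifferentiableAt_frameAt k),
    covAlong_comp _ hf (mdifferentiableAt_frameAt l)]
  exact h2.trans h1

end Metric

section Endomorphism

variable {J : Π x : M', TangentSpace I' x →L[ℝ] TangentSpace I' x}

theorem DiffAlongAt.clm_apply
    (hJ : ContMDiff I' (I'.prod 𝓘(ℝ, E' →L[ℝ] E')) ∞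
      (fun x => TotalSpace.mk' (E' →L[ℝ] E')
        (E := fun x : M' => TangentSpace I' x →L[ℝ] TangentSpace I' x) x (J x)))
    (hV : DiffAlongAt I I' f x V) : DiffAlongAt I I' f x (fun y => J (f y) (V y)) :=
  MDifferentiableAt.clm_bundle_apply (IB := I') (F₁ := E') (F₂ := E')
    (E₁ := (TangentSpace I' : M' → Type _)) (E₂ := (TangentSpace I' : M' → Type _))
    (ϕ := fun y => J (f y)) (v := V)
    ((hJ.mdifferentiableAt (by simp)).comp x hV.mdifferentiableAt_base) hV

theorem covAlong_clm_apply
    (hJ : ContMDiff I' (I'.prod 𝓘(ℝ, E' →L[ℝ] E')) ∞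
      (fun x => TotalSpace.mk' (E' →L[ℝ] E')
        (E := fun x : M' => TangentSpace I' x →L[ℝ] TangentSpace I' x) x (J x)))
    (hpar : ∀ (x : M') (Y : Π x : M', TangentSpace I' x), CMDiffAt ∞ (T% Y) x →
      covDerivEndo I' cov J Y x = 0)
    (hV : DiffAlongAt I I' f x V) (v : TangentSpace I x) :
    covAlong I I' cov f (fun y => J (f y) (V y)) x v = J (f x) (covAlong I I' cov f V x v) := by
  have hf := hV.mdifferentiableAt_base
  have hs (k) := diffAlongAt_comp hf (mdifferentiableAt_frameAt (I' := I') (f := f) (x := x) k)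
  have hJs (k) : MDiffAt (T% fun z => J z (frameAt I' f x k z)) (f x) :=
    DiffAlongAt.clm_apply (f := fun z : M' => z) (I := I') hJ (mdifferentiableAt_frameAt k)
  have h1 : ∀ᶠ y in 𝓝 x, J (f y) (V y)
      = ∑ k, coeffAt I' f x k (f y) (V y) • J (f y) (frameAt I' f x k (f y)) := by
    filter_upwards [eventually_sum_coeffAt_frameAt hf.continuousAt V] with y hy
    nth_rewrite 1 [hy]
    simp
  have h2 (k) : DiffAlongAt I I' f x
      (fun y => coeffAt I' f x k (f y) (V y) • J (f y) (frameAt I' f x k (f y))) := by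
    exact (hV.mdifferentiableAt_coeffAt k).smul_along ((hs k).clm_apply hJ)
  rw [covAlong_congr _ h1, covAlong_sum _ _ fun k _ => h2 k, covAlong_apply, map_sum]
  simp only [sum_apply]
  refine Finset.sum_congr rfl fun k _ => ?_
  rw [covAlong_smul _ (hV.mdifferentiableAt_coeffAt k) ((hs k).clm_apply hJ),
    covAlong_comp (W := fun z => J z (frameAt I' f x k z)) _ hf (hJs k)]
  have h3 := congr($(hpar (f x) (frameAt I' f x k) (contMDiffAt_frameAt k)) (mfderiv I I' f x v))
  simp only [covDerivEndo, sub_apply, ContinuousLinearMap.comp_apply,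
    zero_apply, sub_eq_zero] at h3
  simp [h3]

end Endomorphism

end AlongMap

section Bracket

open VectorField

variable {E : Type*} [NormedAddCommGroup E] [NormedSpace ℝ E] [FiniteDimensional ℝ E]
  {H : Type*} [TopologicalSpace H] {I : ModelWithCorners ℝ E H} [I.Boundaryless]
  {M : Type*} [TopologicalSpace M] [ChartedSpace H M] [IsManifold I ∞ M]
  {F : Type*} [NormedAddCommGroup F] [NormedSpace ℝ F]
  {φ : M → F} {x : M} {X Y : Π x : M, TangentSpace I x}

variable (I x X) in
/-- The vector field `X` read in the preferred chart around `x`. -/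
noncomputable def chartField (z : E) : E :=
  mpullbackWithin 𝓘(ℝ, E) I (extChartAt I x).symm X (Set.range I) z

theorem differentiableAt_chartField (hX : MDiffAt (T% X) x) :
    DifferentiableAt ℝ (chartField I x X) (extChartAt I x x) := by
  have : IsManifold I 2 M := IsManifold.of_le (n := ∞) ENat.LEInfty.out
  have h := MDifferentiableWithinAt.differentiableWithinAt_mpullbackWithin_vectorField
    hX.mdifferentiableWithinAt (s := Set.univ)
  rw [Set.preimage_univ, Set.univ_inter] at h
  exact h.differentiableAt (by rw [I.range_eq_univ]; exact Filter.univ_mem)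

theorem chartField_self : chartField I x X (extChartAt I x x) = X x := by
  simp only [chartField, mpullbackWithin_apply]
  rw [extChartAt_to_inv]
  exact mfderivWithin_extChartAt_symm_inverse_apply (X x)

theorem mlieBracket_eq_chartField :
    mlieBracket I X Y x
      = fderiv ℝ (chartField I x Y) (extChartAt I x x) (X x)
        - fderiv ℝ (chartField I x X) (extChartAt I x x) (Y x) := by
  have h : mlieBracket I X Y x = (mfderiv I 𝓘(ℝ, E) (extChartAt I x) x).inverse
      (lieBracketWithin ℝ (E := E) (chartField I x X) (chartField I x Y)
        ((extChartAt I x).symm ⁻¹' Set.univ ∩ Set.range I) (extChartAt I x x) : E) := rfl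
  rw [h, mfderiv_extChartAt_self, Set.preimage_univ, Set.univ_inter, I.range_eq_univ,
    lieBracketWithin_univ]
  refine (congr($(ContinuousLinearMap.inverse_id (R := ℝ) (M := E)) _)).trans ?_
  rw [ContinuousLinearMap.id_apply, lieBracket, chartField_self, chartField_self]

theorem mvfderiv_eq_fderiv_chart (hφ : MDiffAt φ x) (v : TangentSpace I x) :
    mvfderiv I φ x v = fderiv ℝ (φ ∘ (extChartAt I x).symm) (extChartAt I x x) v := by
  rw [hφ.mvfderiv, I.range_eq_univ, fderivWithin_univ]
  rfl

theorem fderiv_chart_chartField {z : E} (hz : z ∈ (extChartAt I x).target)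
    (hφ : MDiffAt φ ((extChartAt I x).symm z)) :
    fderiv ℝ (φ ∘ (extChartAt I x).symm) z (chartField I x X z)
      = mvfderiv I φ ((extChartAt I x).symm z) (X ((extChartAt I x).symm z)) := by
  have h1 : MDifferentiableAt 𝓘(ℝ, E) I (extChartAt I x).symm z := by
    have := mdifferentiableWithinAt_extChartAt_symm hz
    rwa [I.range_eq_univ, mdifferentiableWithinAt_univ] at this
  have h2 := mfderiv_comp z hφ h1
  rw [mfderiv_eq_fderiv] at h2
  have h3 := isInvertible_mfderivWithin_extChartAt_symm hz
  have h4 := h3.self_apply_inverse (X ((extChartAt I x).symm z))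
  rw [h2]
  simp only [I.range_eq_univ, mfderivWithin_univ] at h4
  simp only [chartField, mpullbackWithin_apply, I.range_eq_univ, mfderivWithin_univ]
  exact congrArg (mvfderiv I φ ((extChartAt I x).symm z)) h4

theorem mvfderiv_mvfderiv_apply (hφ : CMDiffAt ∞ φ x) (hY : MDiffAt (T% Y) x)
    (v : TangentSpace I x) :
    MDiffAt (fun y => mvfderiv I φ y (Y y)) x ∧
    mvfderiv I (fun y => mvfderiv I φ y (Y y)) x v
      = fderiv ℝ (fderiv ℝ (φ ∘ (extChartAt I x).symm)) (extChartAt I x x) v (Y x)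
        + mvfderiv I φ x (fderiv ℝ (chartField I x Y) (extChartAt I x x) v) := by
  set z := extChartAt I x x with hz
  set φ' := φ ∘ (extChartAt I x).symm with hφ'
  have hsmooth : ContDiffAt ℝ ∞ φ' z := by
    have := (contMDiffAt_iff.1 hφ).2
    rwa [I.range_eq_univ, contDiffWithinAt_univ] at this
  have hev : (fun y => mvfderiv I φ y (Y y)) ∘ (extChartAt I x).symm
      =ᶠ[𝓝 z] fun w => fderiv ℝ φ' w (chartField I x Y w) := by
    have h1 : ∀ᶠ y in 𝓝 x, MDiffAt φ y := by
      have := (contMDiffAt_iff_contMDiffAt_nhds (n := 1) (by simp)).1 (hφ.of_le (by simp))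
      filter_upwards [this] with y hy using hy.mdifferentiableAt (by simp)
    have h2 : ∀ᶠ w in 𝓝 z, MDiffAt φ ((extChartAt I x).symm w) := by
      have h3 : ContinuousAt (extChartAt I x).symm z := continuousAt_extChartAt_symm x
      rw [ContinuousAt, hz, extChartAt_to_inv] at h3
      exact h3.eventually h1
    filter_upwards [h2, extChartAt_target_mem_nhds (I := I) x] with w hw1 hw2
    exact (fderiv_chart_chartField hw2 hw1).symm
  have hd1 : DifferentiableAt ℝ (fderiv ℝ φ') z :=
    (hsmooth.fderiv_right (m := 1) (by simpa [one_add_one_eq_two] using ENat.LEInfty.out)).differentiableAt (by simp)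
  have hd2 := differentiableAt_chartField hY
  have hd3 : DifferentiableAt ℝ (fun w => fderiv ℝ φ' w (chartField I x Y w)) z :=
    hd1.clm_apply hd2
  have hm : MDiffAt (fun y => mvfderiv I φ y (Y y)) x := by
    rw [← mdifferentiableWithinAt_univ]
    have : IsManifold I 1 M := IsManifold.of_le (n := ∞) ENat.LEInfty.out
    apply DifferentiableWithinAt.mdifferentiableWithinAt_of_comp_extChartAt_symm
    exact (hd3.congr_of_eventuallyEq hev).differentiableWithinAt
  refine ⟨hm, ?_⟩
  rw [mvfderiv_eq_fderiv_chart hm, hev.fderiv_eq, fderiv_clm_apply hd1 hd2]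
  refine Eq.trans ?_ (congrArg₂ (· + ·) rfl
    (mvfderiv_eq_fderiv_chart (hφ.mdifferentiableAt (by simp)) _).symm)
  rw [← chartField_self (X := Y)]
  exact add_comm _ _

/-- The Lie bracket of vector fields, acting as a derivation on smooth functions. -/
theorem mvfderiv_mlieBracket (hφ : CMDiffAt ∞ φ x) (hX : MDiffAt (T% X) x)
    (hY : MDiffAt (T% Y) x) :
    mvfderiv I φ x (mlieBracket I X Y x)
      = mvfderiv I (fun y => mvfderiv I φ y (Y y)) x (X x)
        - mvfderiv I (fun y => mvfderiv I φ y (X y)) x (Y x) := by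
  have hsmooth : ContDiffAt ℝ ∞ (φ ∘ (extChartAt I x).symm) (extChartAt I x x) := by
    have := (contMDiffAt_iff.1 hφ).2
    rwa [I.range_eq_univ, contDiffWithinAt_univ] at this
  have hsymm := hsmooth.isSymmSndFDerivAt (by simpa [minSmoothness_of_isRCLikeNormedField] using ENat.LEInfty.out)
  rw [(mvfderiv_mvfderiv_apply hφ hX _).2, (mvfderiv_mvfderiv_apply hφ hY _).2,
    mlieBracket_eq_chartField]
  have h := hsymm.eq (X x) (Y x)
  refine ((mvfderiv I φ x).map_sub _ _).trans ?_
  rw [h]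
  abel

end Bracket

section Gauss

open VectorField

variable {E : Type*} [NormedAddCommGroup E] [NormedSpace ℝ E] [FiniteDimensional ℝ E]
  {H : Type*} [TopologicalSpace H] {I : ModelWithCorners ℝ E H} [I.Boundaryless]
  {M : Type*} [TopologicalSpace M] [ChartedSpace H M] [IsManifold I ∞ M]
  {E' : Type*} [NormedAddCommGroup E'] [NormedSpace ℝ E'] [FiniteDimensional ℝ E']
  {H' : Type*} [TopologicalSpace H'] {I' : ModelWithCorners ℝ E' H'} [I'.Boundaryless]
  {M' : Type*} [TopologicalSpace M'] [ChartedSpace H' M'] [IsManifold I' ∞ M']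
  {f : M → M'} {x : M} {X Y Z : Π x : M, TangentSpace I x}

variable (I' f x) in
/-- The coordinate functions of the preferred chart around `f x`. -/
noncomputable def chartCoord (k : Fin (Module.finrank ℝ E')) (z : M') : ℝ :=
  ((Module.finBasis ℝ E').coord k).toContinuousLinearMap (extChartAt I' (f x) z)

theorem contMDiffAt_chartCoord {z : M'} (hz : z ∈ (chartAt H' (f x)).source) (k) :
    CMDiffAt ∞ (chartCoord I' f x k) z :=
  ContMDiffAt.comp z (ContinuousLinearMap.contMDiff _).contMDiffAt (contMDiffAt_extChartAt' hz)

open Classical in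
theorem coeffAt_eq_mvfderiv {z : M'} (hz : z ∈ (chartAt H' (f x)).source) (k)
    (v : TangentSpace I' z) :
    coeffAt I' f x k z v = mvfderiv I' (chartCoord I' f x k) z v := by
  set t := trivializationAt E' (TangentSpace I' : M' → Type _) (f x) with ht
  have hz' : z ∈ t.baseSet := by rwa [ht, TangentBundle.trivializationAt_baseSet]
  have h1 : coeffAt I' f x k z v
      = (Module.finBasis ℝ E').repr (t (⟨z, v⟩ : TangentBundle I' M')).2 k := by
    have := t.localFrameCoeff_eq_coeff (I := I') (b := Module.finBasis ℝ E')
      (s := fun z' => if h : z' = z then h ▸ v else 0) hz' (i := k)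
    simpa [coeffAt, ← ht] using this
  have h2 : (t (⟨z, v⟩ : TangentBundle I' M')).2 = t.continuousLinearMapAt ℝ z v := by
    rw [Bundle.Trivialization.continuousLinearMapAt_apply,
      Bundle.Trivialization.linearMapAt_apply, if_pos hz']
  have h4 := congr($(TangentBundle.continuousLinearMapAt_trivializationAt (I := I') hz) v)
  rw [h1, h2]
  refine (congrArg (fun w : E' => (Module.finBasis ℝ E').repr w k) h4).trans ?_
  have h3 := mfderiv_comp_apply (I := I') (I' := 𝓘(ℝ, E')) (I'' := 𝓘(ℝ, ℝ)) z
    (g := ((Module.finBasis ℝ E').coord k).toContinuousLinearMap) (f := extChartAt I' (f x))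
    (ContinuousLinearMap.mdifferentiableAt _) (mdifferentiableAt_extChartAt hz) v
  rw [ContinuousLinearMap.mfderiv_eq] at h3
  exact h3.symm

theorem eventually_mem_chartAt_source (z : M') : ∀ᶠ w in 𝓝 z, w ∈ (chartAt H' z).source :=
  (chartAt H' z).open_source.mem_nhds (mem_chart_source H' z)

theorem mlieBracket_frameAt (j k) :
    mlieBracket I' (frameAt I' f x j) (frameAt I' f x k) (f x) = 0 := by
  have h0 (i l) : mvfderiv I' (fun z => mvfderiv I' (chartCoord I' f x i) z (frameAt I' f x l z))
      (f x) = 0 := by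
    have : (fun z => mvfderiv I' (chartCoord I' f x i) z (frameAt I' f x l z))
        =ᶠ[𝓝 (f x)] fun _ => if l = i then (1 : ℝ) else 0 := by
      filter_upwards [eventually_mem_chartAt_source (H' := H') (f x)] with z hz
      rw [← coeffAt_eq_mvfderiv hz, coeffAt_frameAt]
      rwa [TangentBundle.trivializationAt_baseSet]
    rw [mvfderiv_congr_nhds this, mvfderiv_const]
  rw [sum_coeffAt_frameAt (I' := I') (mem_baseSet_frameAt (f x))
    (mlieBracket I' (frameAt I' f x j) (frameAt I' f x k) (f x))]
  refine Finset.sum_eq_zero fun i _ => ?_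
  rw [coeffAt_eq_mvfderiv (mem_chart_source H' (f x)),
    mvfderiv_mlieBracket (contMDiffAt_chartCoord (mem_chart_source H' (f x)) i)
      (mdifferentiableAt_frameAt j) (mdifferentiableAt_frameAt k), h0, h0]
  simp

theorem diffAlongAt_mfderiv (hf : CMDiff ∞ f) (hY : MDiffAt (T% Y) x) :
    DiffAlongAt I I' f x (fun y => mfderiv I I' f y (Y y)) := by
  have h := hf.contMDiff_tangentMap (m := 1) (by simpa [one_add_one_eq_two] using ENat.LEInfty.out)
  exact MDifferentiableAt.comp x (h.mdifferentiable (by simp) (⟨x, Y x⟩ : TangentBundle I M)) hY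

section Torsion

variable [RiemannianBundle (fun x : M' => TangentSpace I' x)]
  [IsContMDiffRiemannianBundle I' ∞ E' (fun x : M' => TangentSpace I' x)]

theorem leviCivita_frameAt_comm (j k) :
    leviCivita I' M' (frameAt I' f x k) (f x) (frameAt I' f x j (f x))
      = leviCivita I' M' (frameAt I' f x j) (f x) (frameAt I' f x k (f x)) := by
  have h := (CovariantDerivative.torsion_eq_zero_iff _).1 (leviCivita_torsion (M := M') I')
    (mdifferentiableAt_frameAt (I' := I') (f := f) (x := x) j)
    (mdifferentiableAt_frameAt (I' := I') (f := f) (x := x) k)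
  rw [mlieBracket_frameAt] at h
  exact sub_eq_zero.1 h

/-- The pullback of the Levi-Civita connection is torsion-free. -/
theorem covAlong_mfderiv_sub (hf : CMDiff ∞ f) (hX : MDiffAt (T% X) x) (hY : MDiffAt (T% Y) x) :
    covAlong I I' (leviCivita I' M') f (fun y => mfderiv I I' f y (Y y)) x (X x)
      - covAlong I I' (leviCivita I' M') f (fun y => mfderiv I I' f y (X y)) x (Y x)
      = mfderiv I I' f x (mlieBracket I X Y x) := by
  have hfx : MDiffAt f x := hf.mdifferentiable (by simp) x
  have hev : ∀ᶠ y in 𝓝 x, f y ∈ (chartAt H' (f x)).source :=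
    hfx.continuousAt.eventually (eventually_mem_chartAt_source (f x))
  have hcomp {y : M} (hy : f y ∈ (chartAt H' (f x)).source) (k) (v : TangentSpace I y) :
      coeffAt I' f x k (f y) (mfderiv I I' f y v)
        = mvfderiv I (chartCoord I' f x k ∘ f) y v := by
    rw [coeffAt_eq_mvfderiv hy, mvfderiv_comp_apply y
      ((contMDiffAt_chartCoord hy k).mdifferentiableAt (by simp))
      (hf.mdifferentiable (by simp) y)]
  have hd (k) (Y : Π x : M, TangentSpace I x) :
      mvfderiv I (fun y => coeffAt I' f x k (f y) (mfderiv I I' f y (Y y))) x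
        = mvfderiv I (fun y => mvfderiv I (chartCoord I' f x k ∘ f) y (Y y)) x := by
    refine mvfderiv_congr_nhds ?_
    filter_upwards [hev] with y hy using hcomp hy k _
  have hx := mem_chart_source H' (f x)
  have hb (k) := mvfderiv_mlieBracket
    ((contMDiffAt_chartCoord (I' := I') hx k).comp x hf.contMDiffAt) hX hY
  have hterm (X Y : Π x : M, TangentSpace I x) :
      ∑ k, coeffAt I' f x k (f x) (mfderiv I I' f x (Y x)) •
          leviCivita I' M' (frameAt I' f x k) (f x) (mfderiv I I' f x (X x))
        = ∑ k, ∑ j, (coeffAt I' f x k (f x) (mfderiv I I' f x (Y x))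
          * coeffAt I' f x j (f x) (mfderiv I I' f x (X x))) •
          leviCivita I' M' (frameAt I' f x k) (f x) (frameAt I' f x j (f x)) := by
    refine Finset.sum_congr rfl fun k _ => ?_
    nth_rewrite 1 [sum_coeffAt_frameAt (I' := I') (mem_baseSet_frameAt (f x))
      (mfderiv I I' f x (X x))]
    rw [map_sum, Finset.smul_sum]
    refine Finset.sum_congr rfl fun j _ => ?_
    rw [map_smul, smul_smul]
  rw [covAlong_apply, covAlong_apply, Finset.sum_add_distrib, Finset.sum_add_distrib,
    hterm X Y, hterm Y X, Finset.sum_comm (f := fun k j => (_ * _) • _)]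
  have hswap : ∀ j k, (coeffAt I' f x k (f x) (mfderiv I I' f x (Y x))
          * coeffAt I' f x j (f x) (mfderiv I I' f x (X x))) •
          leviCivita I' M' (frameAt I' f x k) (f x) (frameAt I' f x j (f x))
      = (coeffAt I' f x j (f x) (mfderiv I I' f x (X x))
          * coeffAt I' f x k (f x) (mfderiv I I' f x (Y x))) •
          leviCivita I' M' (frameAt I' f x j) (f x) (frameAt I' f x k (f x)) := fun j k => by
    rw [leviCivita_frameAt_comm, mul_comm]
  simp only [hswap, add_sub_add_right_eq_sub]
  rw [sum_coeffAt_frameAt (I' := I') (mem_baseSet_frameAt (f x))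
    (mfderiv I I' f x (mlieBracket I X Y x)), ← Finset.sum_sub_distrib]
  refine Finset.sum_congr rfl fun k _ => ?_
  rw [hcomp hx, hb, hd, hd, sub_smul]

variable [RiemannianBundle (fun x : M => TangentSpace I x)]
  [IsContMDiffRiemannianBundle I ∞ E (fun x : M => TangentSpace I x)]

theorem inner_covAlong_mfderiv (hf : IsIsometricImmersion I I' f) (hX : MDiffAt (T% X) x)
    (hY : MDiffAt (T% Y) x) (hZ : MDiffAt (T% Z) x) :
    inner ℝ (covAlong I I' (leviCivita I' M') f (fun y => mfderiv I I' f y (Y y)) x (X x))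
      (mfderiv I I' f x (Z x)) = inner ℝ (leviCivita I M Y x (X x)) (Z x) := by
  have hm {A B C : Π x : M, TangentSpace I x} (hA : MDiffAt (T% A) x) (hB : MDiffAt (T% B) x) :
      mvfderiv I (fun y => inner ℝ (A y) (B y)) x (C x)
      = inner ℝ (covAlong I I' (leviCivita I' M') f (fun y => mfderiv I I' f y (A y)) x (C x))
          (mfderiv I I' f x (B x))
        + inner ℝ (covAlong I I' (leviCivita I' M') f (fun y => mfderiv I I' f y (B y)) x (C x))
          (mfderiv I I' f x (A x)) := by
    have := covAlong_metric (diffAlongAt_mfderiv hf.contMDiff hA)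
      (diffAlongAt_mfderiv hf.contMDiff hB) (C x)
    simp only [hf.inner_mfderiv] at this
    rw [this, real_inner_comm _ (mfderiv I I' f x (A x))]
  have hb {A B : Π x : M, TangentSpace I x} (C : Π x : M, TangentSpace I x)
      (hA : MDiffAt (T% A) x) (hB : MDiffAt (T% B) x) :
      inner ℝ (mlieBracket I A B x) (C x)
      = inner ℝ (covAlong I I' (leviCivita I' M') f (fun y => mfderiv I I' f y (B y)) x (A x))
          (mfderiv I I' f x (C x))
        - inner ℝ (covAlong I I' (leviCivita I' M') f (fun y => mfderiv I I' f y (A y)) x (B x))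
          (mfderiv I I' f x (C x)) := by
    rw [← inner_sub_left, covAlong_mfderiv_sub hf.contMDiff hA hB, hf.inner_mfderiv]
  have hk := leviCivita_koszul I hY hX hZ
  rw [koszul, hm hY hZ, hm hX hZ, hm hX hY, hb Z hX hY, hb Y hX hZ, hb X hY hZ] at hk
  linarith

/-- The Gauss formula: the tangential part of `∇'_v (f_* Y)` is `∇_v Y`. -/
theorem tangentialPart_covAlong_mfderiv (hf : IsIsometricImmersion I I' f)
    (hY : MDiffAt (T% Y) x) (v : TangentSpace I x) :
    tangentialPart I I' f x
      (covAlong I I' (leviCivita I' M') f (fun y => mfderiv I I' f y (Y y)) x v)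
      = leviCivita I M Y x v := by
  refine ext_inner_right ℝ fun w => ?_
  rw [inner_tangentialPart]
  simpa using inner_covAlong_mfderiv hf
    (FiberBundle.mdifferentiableAt_extend (F := E) (x := x) I v) hY
    (FiberBundle.mdifferentiableAt_extend (F := E) (x := x) I w)

end Torsion

end Gauss

section OrthogonalFrame

variable {E : Type*} [NormedAddCommGroup E] [NormedSpace ℝ E] [FiniteDimensional ℝ E]
  {H : Type*} [TopologicalSpace H] {I : ModelWithCorners ℝ E H}
  {M : Type*} [TopologicalSpace M] [ChartedSpace H M] [IsManifold I ∞ M]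
  [RiemannianBundle (fun x : M => TangentSpace I x)]
  [IsContMDiffRiemannianBundle I ∞ E (fun x : M => TangentSpace I x)]
  {x : M}

open InnerProductSpace in
theorem sum_inner_gramSchmidt {V : Type*} [NormedAddCommGroup V] [InnerProductSpace ℝ V]
    {n : ℕ} {s : Fin n → V} (hs : LinearIndependent ℝ s)
    (hspan : ⊤ ≤ Submodule.span ℝ (Set.range s)) (v : V) :
    v = ∑ k, ((inner ℝ (gramSchmidt ℝ s k) (gramSchmidt ℝ s k))⁻¹
      * inner ℝ v (gramSchmidt ℝ s k) : ℝ) • gramSchmidt ℝ s k := by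
  have hspan' : ⊤ ≤ Submodule.span ℝ (Set.range (gramSchmidtNormed ℝ s)) := by
    rwa [span_gramSchmidtNormed_range, span_gramSchmidt]
  have h := (OrthonormalBasis.mk (gramSchmidtNormed_orthonormal hs) hspan').sum_repr' v
  rw [OrthonormalBasis.coe_mk] at h
  nth_rewrite 1 [← h]
  refine Finset.sum_congr rfl fun k _ => ?_
  simp only [gramSchmidtNormed, inner_smul_left, smul_smul, real_inner_self_eq_norm_sq,
    real_inner_comm (gramSchmidt ℝ s k) v]
  congr 1
  simp
  ring

open InnerProductSpace in
theorem mdifferentiableAt_gramSchmidt {n : ℕ} {s : Fin n → Π y : M, TangentSpace I y}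
    (hs : ∀ k, MDiffAt (T% fun y => s k y) x) (hli : LinearIndependent ℝ (fun k => s k x)) (k : Fin n) :
    MDiffAt (T% fun y => gramSchmidt ℝ (fun l => s l y) k) x := by
  induction k using WellFoundedLT.induction with
  | ind k ih =>
  have h1 (y : M) : gramSchmidt ℝ (fun l => s l y) k = s k y -
      ∑ i ∈ Finset.Iio k, ((inner ℝ (gramSchmidt ℝ (fun l => s l y) i) (s k y) : ℝ)
        * (inner ℝ (gramSchmidt ℝ (fun l => s l y) i) (gramSchmidt ℝ (fun l => s l y) i))⁻¹)
        • gramSchmidt ℝ (fun l => s l y) i := by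
    rw [eq_sub_iff_add_eq]
    refine Eq.trans ?_ (gramSchmidt_def'' ℝ (fun l => s l y) k).symm
    simp only [real_inner_self_eq_norm_sq, div_eq_mul_inv]
    rfl
  simp only [h1]
  refine mdifferentiableAt_sub_section (hs k) (.sum_section fun i hi => ?_)
  have hi' := ih i (Finset.mem_Iio.1 hi)
  refine MDifferentiableAt.smul_section
    (f := fun y => (inner ℝ (gramSchmidt ℝ (fun l => s l y) i) (s k y) : ℝ)
        * (inner ℝ (gramSchmidt ℝ (fun l => s l y) i) (gramSchmidt ℝ (fun l => s l y) i))⁻¹) ?_ hi'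
  refine (mdifferentiableAt_inner_tangent I hi' (hs k)).mul ?_
  refine (differentiableAt_inv ?_).comp_mdifferentiableAt
    (mdifferentiableAt_inner_tangent I hi' hi')
  rw [ne_eq, inner_self_eq_zero]
  exact gramSchmidt_ne_zero i hli

open InnerProductSpace in
theorem mdifferentiableAt_of_inner {Z : Π y : M, TangentSpace I y}
    (h : ∀ W : Π y : M, TangentSpace I y, MDiffAt (T% W) x →
      MDiffAt (fun y => inner ℝ (Z y) (W y)) x) : MDiffAt (T% Z) x := by
  set t := trivializationAt E (TangentSpace I : M → Type _) x with ht
  have hx : x ∈ t.baseSet := FiberBundle.mem_baseSet_trivializationAt E (TangentSpace I) x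
  have hfr := t.isLocalFrameOn_localFrame_baseSet I 1 (Module.finBasis ℝ E)
  have hs (k) : MDiffAt (T% (t.localFrame (Module.finBasis ℝ E) k)) x :=
    (hfr.contMDiffAt t.open_baseSet hx k).mdifferentiableAt (by simp)
  have he := mdifferentiableAt_gramSchmidt hs (hfr.linearIndependent hx)
  set e := fun k y => gramSchmidt ℝ (fun l => t.localFrame (Module.finBasis ℝ E) l y) k with hedef
  have hne (k) : (inner ℝ (e k x) (e k x) : ℝ) ≠ 0 := by
    rw [ne_eq, inner_self_eq_zero]
    exact gramSchmidt_ne_zero k (hfr.linearIndependent hx)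
  have hsum : MDiffAt (T% fun y => ∑ k, ((inner ℝ (e k y) (e k y))⁻¹
      * inner ℝ (Z y) (e k y) : ℝ) • e k y) x := by
    refine .sum_section fun k _ => ?_
    refine MDifferentiableAt.smul_section
      (f := fun y => ((inner ℝ (e k y) (e k y))⁻¹ * inner ℝ (Z y) (e k y) : ℝ)) ?_ (he k)
    have h1 : MDiffAt (fun y => (inner ℝ (e k y) (e k y) : ℝ)⁻¹) x :=
      (differentiableAt_inv (hne k)).comp_mdifferentiableAt
        (f := fun y => (inner ℝ (e k y) (e k y) : ℝ))
        (mdifferentiableAt_inner_tangent I (he k) (he k))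
    exact h1.mul (h (e k) (he k))
  refine hsum.congr_of_eventuallyEq ?_
  filter_upwards [t.open_baseSet.mem_nhds hx] with y hy
  congr 1
  exact sum_inner_gramSchmidt (hfr.linearIndependent hy) (hfr.generating hy) (Z y)

end OrthogonalFrame

section Submanifold

variable {r : ℕ}
  {E : Type*} [NormedAddCommGroup E] [NormedSpace ℝ E] [FiniteDimensional ℝ E]
  {H : Type*} [TopologicalSpace H] {I : ModelWithCorners ℝ E H} [I.Boundaryless]
  {M : Type*} [TopologicalSpace M] [ChartedSpace H M] [IsManifold I ∞ M]
  [RiemannianBundle (fun x : M => TangentSpace I x)]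
  [IsContMDiffRiemannianBundle I ∞ E (fun x : M => TangentSpace I x)]
  {E' : Type*} [NormedAddCommGroup E'] [NormedSpace ℝ E'] [FiniteDimensional ℝ E']
  {H' : Type*} [TopologicalSpace H'] {I' : ModelWithCorners ℝ E' H'} [I'.Boundaryless]
  {M' : Type*} [TopologicalSpace M'] [ChartedSpace H' M'] [IsManifold I' ∞ M']
  [RiemannianBundle (fun x : M' => TangentSpace I' x)]
  [IsContMDiffRiemannianBundle I' ∞ E' (fun x : M' => TangentSpace I' x)]
  {f : M → M'} {U : Set M} {N : Fin r → Π x : M, TangentSpace I' (f x)}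
  {x : M} {X Y : Π x : M, TangentSpace I x} {V : Π x : M, TangentSpace I' (f x)}

theorem DiffAlongAt.mdifferentiableAt_tangentialPart (hf : IsIsometricImmersion I I' f)
    (hV : DiffAlongAt I I' f x V) : MDiffAt (T% fun y => tangentialPart I I' f y (V y)) x := by
  refine mdifferentiableAt_of_inner fun W hW => ?_
  simp only [inner_tangentialPart]
  exact hV.inner (diffAlongAt_mfderiv hf.contMDiff hW)

theorem IsOrthonormalNormalFrameOn.diffAlongAt (hN : IsOrthonormalNormalFrameOn I I' f U N)
    (hU : IsOpen U) (hx : x ∈ U) (α : Fin r) : DiffAlongAt I I' f x (N α) :=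
  ((hN.contMDiffOn α).contMDiffAt (hU.mem_nhds hx)).mdifferentiableAt (by simp)

/-- The shape operator is dual to the second fundamental form. -/
theorem inner_covAlong_mfderiv_normal (hf : IsIsometricImmersion I I' f) (hU : IsOpen U)
    (hN : IsOrthonormalNormalFrameOn I I' f U N) (hx : x ∈ U) (hY : MDiffAt (T% Y) x)
    (v : TangentSpace I x) (α : Fin r) :
    inner ℝ (covAlong I I' (leviCivita I' M') f (fun y => mfderiv I I' f y (Y y)) x v) (N α x)
      = inner ℝ (shapeOperator I I' f N α x v) (Y x) := by
  have h := covAlong_metric (diffAlongAt_mfderiv hf.contMDiff hY) (hN.diffAlongAt hU hx α) v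
  have h0 : (fun y => (inner ℝ (mfderiv I I' f y (Y y)) (N α y) : ℝ)) =ᶠ[𝓝 x] fun _ => 0 := by
    filter_upwards [hU.mem_nhds hx] with y hy using hN.normal α y hy _
  rw [mvfderiv_congr_nhds h0, mvfderiv_const, zero_apply] at h
  simp only [shapeOperator, neg_apply, ContinuousLinearMap.comp_apply, inner_neg_left,
    inner_tangentialPart]
  rw [real_inner_comm _ (mfderiv I I' f x (Y x))] at h
  linarith

/-- The Gauss formula. -/
theorem covAlong_mfderiv_eq (hdim : Module.finrank ℝ E' = Module.finrank ℝ E + r)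
    (hf : IsIsometricImmersion I I' f) (hN : IsOrthonormalNormalFrameOn I I' f U N) (hx : x ∈ U)
    (hY : MDiffAt (T% Y) x) (v : TangentSpace I x) :
    covAlong I I' (leviCivita I' M') f (fun y => mfderiv I I' f y (Y y)) x v
      = mfderiv I I' f x (leviCivita I M Y x v)
        + ∑ α, (inner ℝ (covAlong I I' (leviCivita I' M') f
          (fun y => mfderiv I I' f y (Y y)) x v) (N α x) : ℝ) • N α x := by
  rw [← tangentialPart_covAlong_mfderiv hf hY]
  exact tangential_add_normal hdim hf hN hx _

/-- The Weingarten formula. -/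
theorem covAlong_normal_eq (hdim : Module.finrank ℝ E' = Module.finrank ℝ E + r)
    (hf : IsIsometricImmersion I I' f) (hN : IsOrthonormalNormalFrameOn I I' f U N) (hx : x ∈ U)
    (v : TangentSpace I x) (α : Fin r) :
    covAlong I I' (leviCivita I' M') f (N α) x v
      = -mfderiv I I' f x (shapeOperator I I' f N α x v)
        + ∑ β, normalConnection I I' f N α β x v • N β x := by
  have h := tangential_add_normal hdim hf hN hx (covAlong I I' (leviCivita I' M') f (N α) x v)
  simp only [shapeOperator, neg_apply, ContinuousLinearMap.comp_apply, map_neg, neg_neg,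
    normalConnection, innerSL_apply_apply, real_inner_comm _ (N _ x)]
  exact h

theorem leviCivita_tangentialPart (hdim : Module.finrank ℝ E' = Module.finrank ℝ E + r)
    (hf : IsIsometricImmersion I I' f) (hU : IsOpen U)
    (hN : IsOrthonormalNormalFrameOn I I' f U N) (hx : x ∈ U)
    (hV : DiffAlongAt I I' f x V) (v : TangentSpace I x) :
    leviCivita I M (fun y => tangentialPart I I' f y (V y)) x v
      = tangentialPart I I' f x (covAlong I I' (leviCivita I' M') f V x v)
        + ∑ α, (inner ℝ (V x) (N α x) : ℝ) • shapeOperator I I' f N α x v := by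
  refine ext_inner_right ℝ fun w => ?_
  set W : Π y : M, TangentSpace I y := FiberBundle.extend E w with hWdef
  have hW : MDiffAt (T% W) x := FiberBundle.mdifferentiableAt_extend ..
  have hWx : W x = w := FiberBundle.extend_apply_self ..
  have h1 := leviCivita_metric I (hV.mdifferentiableAt_tangentialPart hf) hW v
  have h2 := covAlong_metric hV (diffAlongAt_mfderiv hf.contMDiff hW) v
  simp only [inner_tangentialPart] at h1
  rw [covAlong_mfderiv_eq hdim hf hN hx hW v] at h2
  simp only [inner_covAlong_mfderiv_normal hf hU hN hx hW, inner_add_right, inner_sum,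
    inner_smul_right, hWx] at h2
  rw [hWx] at h1
  rw [inner_add_left, sum_inner, inner_tangentialPart]
  simp only [inner_smul_left, RCLike.conj_to_real]
  have h3 : ∑ α, (inner ℝ (shapeOperator I I' f N α x v) w : ℝ) * inner ℝ (V x) (N α x)
      = ∑ α, (inner ℝ (V x) (N α x) : ℝ) * inner ℝ (shapeOperator I I' f N α x v) w :=
    Finset.sum_congr rfl fun _ _ => mul_comm _ _
  linarith

variable {p q : ℕ} {J : Π x : M', TangentSpace I' x →L[ℝ] TangentSpace I' x}

theorem covDerivEndo_inducedP (hdim : Module.finrank ℝ E' = Module.finrank ℝ E + r)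
    (hJ : IsLocallyMetallicRiemannian I' p q J)
    (hf : IsIsometricImmersion I I' f) (hU : IsOpen U)
    (hN : IsOrthonormalNormalFrameOn I I' f U N) (hx : x ∈ U) (hY : MDiffAt (T% Y) x) :
    covDerivEndo I (leviCivita I M) (inducedP I I' f J) Y x (X x)
      = ∑ α, secondFundamentalForm I I' f N α X Y x • inducedXi I I' f J N α x
        + ∑ α, inducedU I I' f J N α x (Y x) • shapeOperator I I' f N α x (X x) := by
  have hfY := diffAlongAt_mfderiv (I' := I') hf.contMDiff hY
  have h := leviCivita_tangentialPart hdim hf hU hN hx (hfY.clm_apply hJ.contMDiff) (X x)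
  rw [covAlong_clm_apply _ hJ.contMDiff hJ.parallel hfY,
    covAlong_mfderiv_eq hdim hf hN hx hY (X x)] at h
  simp only [map_add, map_sum, map_smul] at h
  have h' : leviCivita I M (fun y => inducedP I I' f J y (Y y)) x (X x) = _ := h
  simp only [covDerivEndo, sub_apply, ContinuousLinearMap.comp_apply]
  rw [h', sub_eq_iff_eq_add, add_assoc, add_comm]
  simp only [inducedU, ContinuousLinearMap.comp_apply, innerSL_apply_apply,
    real_inner_comm _ (N _ x)]
  rfl

theorem covDerivForm_inducedU (hdim : Module.finrank ℝ E' = Module.finrank ℝ E + r)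
    (hJ : IsLocallyMetallicRiemannian I' p q J)
    (hf : IsIsometricImmersion I I' f) (hU : IsOpen U)
    (hN : IsOrthonormalNormalFrameOn I I' f U N) (hx : x ∈ U) (hY : MDiffAt (T% Y) x)
    (α : Fin r) :
    covDerivForm I (leviCivita I M) (inducedU I I' f J N α) Y x (X x)
      = -secondFundamentalForm I I' f N α X (fun y => inducedP I I' f J y (Y y)) x
        + ∑ β, (normalConnection I I' f N α β x (X x) * inducedU I I' f J N β x (Y x)
          + inducedA I' f J N β α x * secondFundamentalForm I I' f N β X Y x) := by
  have hfY := diffAlongAt_mfderiv (I' := I') hf.contMDiff hY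
  have hJY := hfY.clm_apply hJ.contMDiff
  have h := covAlong_metric (hN.diffAlongAt hU hx α) hJY (X x)
  rw [covAlong_clm_apply _ hJ.contMDiff hJ.parallel hfY,
    covAlong_mfderiv_eq hdim hf hN hx hY (X x), covAlong_normal_eq hdim hf hN hx] at h
  have hP : secondFundamentalForm I I' f N α X (fun y => inducedP I I' f J y (Y y)) x
      = inner ℝ (mfderiv I I' f x (shapeOperator I I' f N α x (X x)))
        (J (f x) (mfderiv I I' f x (Y x))) := by
    refine (inner_covAlong_mfderiv_normal hf hU hN hx
      (hJY.mdifferentiableAt_tangentialPart hf) (X x) α).trans ?_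
    rw [real_inner_comm, inner_tangentialPart, real_inner_comm]
  have h' : mvfderiv I (fun y => inducedU I I' f J N α y (Y y)) x (X x) = _ := h
  simp only [covDerivForm, sub_apply, ContinuousLinearMap.comp_apply]
  rw [h', hP]
  simp only [map_add, map_sum, map_smul, inner_add_left, inner_add_right, inner_neg_left,
    sum_inner, inner_sum, inner_smul_left, inner_smul_right, RCLike.conj_to_real,
    Finset.sum_add_distrib, inducedU, inducedA, ContinuousLinearMap.comp_apply,
    innerSL_apply_apply, secondFundamentalForm, real_inner_comm (N α x), mul_comm]
  ring

theorem leviCivita_inducedXi (hdim : Module.finrank ℝ E' = Module.finrank ℝ E + r)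
    (hJ : IsLocallyMetallicRiemannian I' p q J)
    (hf : IsIsometricImmersion I I' f) (hU : IsOpen U)
    (hN : IsOrthonormalNormalFrameOn I I' f U N) (hx : x ∈ U) (v : TangentSpace I x)
    (α : Fin r) :
    leviCivita I M (inducedXi I I' f J N α) x v
      = -inducedP I I' f J x (shapeOperator I I' f N α x v)
        + ∑ β, inducedA I' f J N α β x • shapeOperator I I' f N β x v
        + ∑ β, normalConnection I I' f N α β x v • inducedXi I I' f J N β x := by
  have hNα := hN.diffAlongAt hU hx α
  have h := leviCivita_tangentialPart hdim hf hU hN hx (hNα.clm_apply hJ.contMDiff) v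
  rw [covAlong_clm_apply _ hJ.contMDiff hJ.parallel hNα,
    covAlong_normal_eq hdim hf hN hx] at h
  simp only [map_add, map_sum, map_smul, map_neg] at h
  refine Eq.trans h ?_
  rw [add_right_comm]
  rfl

theorem mvfderiv_inducedA (hdim : Module.finrank ℝ E' = Module.finrank ℝ E + r)
    (hJ : IsLocallyMetallicRiemannian I' p q J)
    (hf : IsIsometricImmersion I I' f) (hU : IsOpen U)
    (hN : IsOrthonormalNormalFrameOn I I' f U N) (hx : x ∈ U) (v : TangentSpace I x)
    (α β : Fin r) :
    mvfderiv I (inducedA I' f J N α β) x v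
      = -inducedU I I' f J N α x (shapeOperator I I' f N β x v)
        - inducedU I I' f J N β x (shapeOperator I I' f N α x v)
        + ∑ γ, (inducedA I' f J N γ β x * normalConnection I I' f N α γ x v
          + inducedA I' f J N α γ x * normalConnection I I' f N β γ x v) := by
  have hNα := hN.diffAlongAt hU hx α
  have h := covAlong_metric (hNα.clm_apply hJ.contMDiff) (hN.diffAlongAt hU hx β) v
  rw [covAlong_clm_apply _ hJ.contMDiff hJ.parallel hNα,
    covAlong_normal_eq hdim hf hN hx, covAlong_normal_eq hdim hf hN hx] at h
  have h' : mvfderiv I (inducedA I' f J N α β) x v = _ := h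
  rw [h']
  simp only [map_add, map_sum, map_smul, map_neg, inner_add_right,
    inner_neg_right, inner_sum, inner_smul_right, Finset.sum_add_distrib, inducedU, inducedA,
    ContinuousLinearMap.comp_apply, innerSL_apply_apply, hJ.symm (f x) (N α x) (mfderiv _ _ _ _ _),
    real_inner_comm (N β x), mul_comm]
  ring

end Submanifold

end Calculus

end Metallic

theorem mainTheorem3 {n r p q : ℕ}
    -- the submanifold `M`, of dimension `n`
    {E : Type*} [NormedAddCommGroup E] [NormedSpace ℝ E] [FiniteDimensional ℝ E]
    (hn : Module.finrank ℝ E = n)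
    {H : Type*} [TopologicalSpace H] {I : ModelWithCorners ℝ E H} [I.Boundaryless]
    {M : Type*} [TopologicalSpace M] [ChartedSpace H M] [IsManifold I ∞ M]
    [RiemannianBundle (fun x : M => TangentSpace I x)]
    [IsContMDiffRiemannianBundle I ∞ E (fun x : M => TangentSpace I x)]
    -- the ambient Riemannian manifold `M'`, of dimension `n + r`
    {E' : Type*} [NormedAddCommGroup E'] [NormedSpace ℝ E'] [FiniteDimensional ℝ E']
    (hr : Module.finrank ℝ E' = n + r)
    {H' : Type*} [TopologicalSpace H'] {I' : ModelWithCorners ℝ E' H'} [I'.Boundaryless]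
    {M' : Type*} [TopologicalSpace M'] [ChartedSpace H' M'] [IsManifold I' ∞ M']
    [RiemannianBundle (fun x : M' => TangentSpace I' x)]
    [IsContMDiffRiemannianBundle I' ∞ E' (fun x : M' => TangentSpace I' x)]
    (J : Π x : M', TangentSpace I' x →L[ℝ] TangentSpace I' x)
    (hJ : IsLocallyMetallicRiemannian I' p q J)
    -- the isometric immersion, and a local orthonormal frame of its normal bundle
    (f : M → M') (hf : IsIsometricImmersion I I' f)
    (U : Set M) (hU : IsOpen U) (N : Fin r → Π x : M, TangentSpace I' (f x))
    (hN : IsOrthonormalNormalFrameOn I I' f U N)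
    (X Y : Π x : M, TangentSpace I x) (hX : CMDiff[U] ∞ (T% X)) (hY : CMDiff[U] ∞ (T% Y)) :
    ∀ x ∈ U,
      -- the formula for `(∇_X P)(Y)`
      covDerivEndo I (leviCivita I M) (inducedP I I' f J) Y x (X x)
          = ∑ α, secondFundamentalForm I I' f N α X Y x • inducedXi I I' f J N α x
            + ∑ α, inducedU I I' f J N α x (Y x) • shapeOperator I I' f N α x (X x) ∧
      -- the formula for `(∇_X u_α)(Y)`
      (∀ α, covDerivForm I (leviCivita I M) (inducedU I I' f J N α) Y x (X x)
          = -secondFundamentalForm I I' f N α X (fun y => inducedP I I' f J y (Y y)) x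
            + ∑ β, (normalConnection I I' f N α β x (X x) * inducedU I I' f J N β x (Y x)
              + inducedA I' f J N β α x * secondFundamentalForm I I' f N β X Y x)) ∧
      -- the formula for `∇_X ξ_α`
      (∀ α, leviCivita I M (inducedXi I I' f J N α) x (X x)
          = -inducedP I I' f J x (shapeOperator I I' f N α x (X x))
            + ∑ β, inducedA I' f J N α β x • shapeOperator I I' f N β x (X x)
            + ∑ β, normalConnection I I' f N α β x (X x) • inducedXi I I' f J N β x) ∧
      -- the formula for `X(a_{αβ})`
      (∀ α β, mvfderiv I (inducedA I' f J N α β) x (X x)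
          = -inducedU I I' f J N α x (shapeOperator I I' f N β x (X x))
            - inducedU I I' f J N β x (shapeOperator I I' f N α x (X x))
            + ∑ γ, (inducedA I' f J N γ β x * normalConnection I I' f N α γ x (X x)
              + inducedA I' f J N α γ x * normalConnection I I' f N β γ x (X x))) := by
  have hdim : Module.finrank ℝ E' = Module.finrank ℝ E + r := by rw [hr, hn]
  intro x hx
  have hYx : MDiffAt (T% Y) x :=
    (hY.contMDiffAt (hU.mem_nhds hx)).mdifferentiableAt (by simp)
  exact ⟨covDerivEndo_inducedP hdim hJ hf hU hN hx hYx,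
    covDerivForm_inducedU hdim hJ hf hU hN hx hYx,
    leviCivita_inducedXi hdim hJ hf hU hN hx (X x),
    mvfderiv_inducedA hdim hJ hf hU hN hx (X x)⟩
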